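/- Let $(\Omega,\mathcal F,\mathbb P)$ be an atomless probability space, $\mathcal X:=L^\infty(\Omega,\mathcal F,\mathbb P)$, and $n\in\mathbb N$. Let $X_1,\dots,X_n\in\mathcal X$ be initial endowments, $S:=\sum_{i=1}^n X_i$, and let $U_1,\dots,U_n:\mathcal X\to\mathbb R$ be utility functionals. For $Z_1,Z_2\in\mathcal X$ write $Z_1\preccurlyeq_{ICV}Z_2$ if $\mathbb E[\phi(Z_1)]\le\mathbb E[\phi(Z_2)]$ for every non-decreasing concave $\phi:\mathbb R\to\mathbb R$, and $Z_1\prec_{ICV}Z_2$ if, in addition, $\mathbb E[\phi(Z_1)]<\mathbb E[\phi(Z_2)]$ for every non-decreasing strictly concave $\phi:\mathbb R\to\mathbb R$. A functional $U:\mathcal X\to\mathbb R$ is S.S.D. preserving if $Z_1\preccurlyeq_{ICV}Z_2$ implies $U(Z_1)\le U(Z_2)$, and strictly S.S.D. preserving if $Z_1\prec_{ICV}Z_2$ implies $U(Z_1)<U(Z_2)$. Let $\mathcal A:=\{(Y_i)_{i=1}^n\in\mathcal X^n:\sum_{i=1}^n Y_i=S\}$ be the set of allocations. Let $\mathcal A_C\subseteq\mathcal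 A$ be the set of comonotone allocations, i.e. those for which there is an event $A$ of probability one with $[Y_i(\omega_1)-Y_i(\omega_2)]\,[Y_j(\omega_1)-Y_j(\omega_2)]\ge 0$ for all $\omega_1,\omega_2\in A$ and all $i,j$. Let $\mathcal{IR}:=\{(Y_i)\in\mathcal A: U_i(Y_i)\ge U_i(X_i)\ \text{for all } i\}$. Let $\mathcal{PO}$ be the set of $(Y_i^*)\in\mathcal{IR}$ for which there is no $(Y_i)\in\mathcal{IR}$ with $U_i(Y_i)\ge U_i(Y_i^*)$ for all $i$ and at least one strict inequality. Let $\mathcal{CPO}$ be the set of $(Y_i^*)\in\mathcal{IR}\cap\mathcal A_C$ for which there is no $(Y_i)\in\mathcal{IR}\cap\mathcal A_C$ with $U_i(Y_i)\ge U_i(Y_i^*)$ for all $i$ and at least one strict inequality. Suppose that each $U_i$ is concave and S.S.D. preserving, and that for all $i$ and all $Z\in\mathcal X$ the function $\mathbb R\to\mathbb R$, $c\mapsto U_i(Z+c)$, is continuous and strictly increasing with $\lim_{c\to\infty}U_i(Z+c)=\infty$. Then $$\mathcal{PO}\cap\mathcal A_C=\mathcal{CPO}.$$ If, in addition, each $U_i$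 is strictly S.S.D. preserving, then $\mathcal{PO}=\mathcal{CPO}$. -/

import Mathlib

open MeasureTheory Filter Set
open scoped ENNReal

namespace RiskSharing

/-- Every event of positive probability contains an event of strictly smaller positive
probability. (Mathlib's condition that singletons are null is weaker.) -/
def Atomless {Ω : Type*} [MeasurableSpace Ω] (P : Measure Ω) : Prop :=
  ∀ A : Set Ω, MeasurableSet A → 0 < P A →
    ∃ B : Set Ω, MeasurableSet B ∧ B ⊆ A ∧ 0 < P B ∧ P B < P A

/-- The space `L^∞(Ω, F, P)` of essentially bounded random variables (modulo a.s. equality). -/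
abbrev Linf {Ω : Type*} [MeasurableSpace Ω] (P : Measure Ω) : Type _ :=
  Lp ℝ ∞ P

section Orders

variable {Ω : Type*} [MeasurableSpace Ω] {P : Measure Ω}

/-- `Z₂` dominates `Z₁` in the increasing concave order (second-order stochastic dominance).
A concave `φ : ℝ → ℝ` is continuous and `Z₁`, `Z₂` are essentially bounded, so both
expectations exist under a probability measure. -/
def ICVLe (Z₁ Z₂ : Linf P) : Prop :=
  ∀ φ : ℝ → ℝ, Monotone φ → ConcaveOn ℝ univ φ →
    ∫ ω, φ (Z₁ ω) ∂P ≤ ∫ ω, φ (Z₂ ω) ∂P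

/-- Strict domination in the increasing concave order. -/
def ICVLt (Z₁ Z₂ : Linf P) : Prop :=
  ICVLe Z₁ Z₂ ∧
    ∀ φ : ℝ → ℝ, Monotone φ → StrictConcaveOn ℝ univ φ →
      ∫ ω, φ (Z₁ ω) ∂P < ∫ ω, φ (Z₂ ω) ∂P

/-- `U` preserves second-order stochastic dominance. -/
def SSDPreserving (U : Linf P → ℝ) : Prop :=
  ∀ Z₁ Z₂ : Linf P, ICVLe Z₁ Z₂ → U Z₁ ≤ U Z₂

/-- `U` strictly preserves strict second-order stochastic dominance. -/
def StrictlySSDPreserving (U : Linf P → ℝ) : Prop :=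
  ∀ Z₁ Z₂ : Linf P, ICVLt Z₁ Z₂ → U Z₁ < U Z₂

/-- For every `Z`, the map `c ↦ U (Z + c)` on `ℝ` is continuous, strictly increasing, and tends
to `∞` as `c → ∞`. -/
def IncreasingInPremium [IsFiniteMeasure P] (U : Linf P → ℝ) : Prop :=
  ∀ Z : Linf P,
    Continuous (fun c : ℝ => U (Z + Lp.const ∞ P c)) ∧
    StrictMono (fun c : ℝ => U (Z + Lp.const ∞ P c)) ∧
    Tendsto (fun c : ℝ => U (Z + Lp.const ∞ P c)) atTop atTop

end Orders

section Market

variable {Ω : Type*} [MeasurableSpace Ω] {P : Measure Ω} {n : ℕ}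

/-- A random vector is comonotone: any two of its components move in the same direction between
any two states. As the components are classes modulo a.s. equality, the states range over an
event of full probability. -/
def Comonotone (Y : Fin n → Linf P) : Prop :=
  ∃ A : Set Ω, (∀ᵐ ω ∂P, ω ∈ A) ∧
    ∀ ω₁ ∈ A, ∀ ω₂ ∈ A, ∀ i j : Fin n,
      0 ≤ (Y i ω₁ - Y i ω₂) * (Y j ω₁ - Y j ω₂)

/-- The allocations of the aggregate endowment `∑ i, X i`. -/
def allocations (X : Fin n → Linf P) : Set (Fin n → Linf P) :=
  {Y | ∑ i, Y i = ∑ i, X i}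

/-- The comonotone allocations of the aggregate endowment. -/
def comonotoneAllocations (X : Fin n → Linf P) : Set (Fin n → Linf P) :=
  {Y | Y ∈ allocations X ∧ Comonotone Y}

/-- The individually rational allocations. -/
def individuallyRational (U : Fin n → Linf P → ℝ) (X : Fin n → Linf P) :
    Set (Fin n → Linf P) :=
  {Y | Y ∈ allocations X ∧ ∀ i, U i (X i) ≤ U i (Y i)}

/-- `Y` makes every agent at least as well off as `Y'`, and some agent strictly better off. -/
def ParetoDominates (U : Fin n → Linf P → ℝ) (Y Y' : Fin n → Linf P) : Prop :=
  (∀ i, U i (Y' i) ≤ U i (Y i)) ∧ ∃ i, U i (Y' i) < U i (Y i)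

/-- The Pareto-optimal allocations. -/
def paretoOptimal (U : Fin n → Linf P → ℝ) (X : Fin n → Linf P) :
    Set (Fin n → Linf P) :=
  {Y | Y ∈ individuallyRational U X ∧
    ¬ ∃ Y' ∈ individuallyRational U X, ParetoDominates U Y' Y}

/-- The comonotone Pareto-optimal allocations: Pareto optima of the market in which only
comonotone allocations are admissible. -/
def comonotoneParetoOptimal (U : Fin n → Linf P → ℝ) (X : Fin n → Linf P) :
    Set (Fin n → Linf P) :=
  {Y | Y ∈ comonotoneAllocations X ∧ Y ∈ individuallyRational U X ∧
    ¬ ∃ Y' ∈ comonotoneAllocations X,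
      Y' ∈ individuallyRational U X ∧ ParetoDominates U Y' Y}

end Market

end RiskSharing

/-!
Comonotone improvement. If `Y` is not comonotone, then two components `Y i`, `Y j` are in strictly
opposite order on two events `A`, `B` of positive probability: `Y i` is large and `Y j` small on
`A`, and conversely on `B`. A small mean-preserving transfer between `A` and `B` pulls `Y i` towards
a constant, and the opposite transfer does the same to `Y j`. Since a concave function lies below
its tangent lines, pulling a random variable towards a constant without changing its mean improves
it strictly in the concave order. Hence `Y` can be improved within the allocations of its total.

The allocations of the same total that improve on `Y` form a nonempty closed convex set in `L²`,
uniformly bounded by the essential bounds of `Y`. Its element of least norm admits no strict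
improvement, because strict improvement decreases second moments, and is therefore comonotone. So a
comonotone allocation that is dominated is dominated by a comonotone one, and under strictly S.S.D.
preserving utilities an allocation that is not comonotone is itself dominated.
-/

namespace RiskSharing

section Supergradient

variable {s : Set ℝ} {φ : ℝ → ℝ} {c q x y : ℝ}

theorem exists_supergradient (hφ : ConcaveOn ℝ s φ) (hq : q ∈ interior s) :
    ∃ c, ∀ x ∈ s, φ x ≤ φ q + c * (x - q) := by
  have hψ : ConvexOn ℝ s (-φ) := hφ.neg
  refine ⟨-derivWithin (-φ) (Ioi q) q, fun x hx => ?_⟩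
  rcases lt_trichotomy x q with h | rfl | h
  · have hslope := (hψ.slope_le_leftDeriv_of_mem_interior hx hq h).trans
      (hψ.leftDeriv_le_rightDeriv_of_mem_interior hq)
    rw [slope_def_field, div_le_iff₀ (sub_pos.2 h)] at hslope
    simp only [Pi.neg_apply] at hslope
    linarith
  · simp
  · have hslope := hψ.rightDeriv_le_slope_of_mem_interior hq hx h
    rw [slope_def_field, le_div_iff₀ (sub_pos.2 h)] at hslope
    simp only [Pi.neg_apply] at hslope
    linarith

theorem lt_of_supergradient (hφ : StrictConcaveOn ℝ s φ) (hq : q ∈ s)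
    (hc : ∀ x ∈ s, φ x ≤ φ q + c * (x - q)) (hx : x ∈ s) (hxq : x ≠ q) :
    φ x < φ q + c * (x - q) := by
  have hhalf : (0 : ℝ) < 1 / 2 := by norm_num
  have hmid := hφ.2 hx hq hxq hhalf hhalf (by norm_num)
  have hle := hc _ (hφ.1 hx hq hhalf.le hhalf.le (by norm_num))
  simp only [smul_eq_mul] at hmid hle
  linarith

theorem add_mul_le_of_mem_segment (hφ : ConcaveOn ℝ s φ) (hx : x ∈ s) (hq : q ∈ s)
    (hc : φ x ≤ φ q + c * (x - q)) (hy : y ∈ segment ℝ x q) :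
    φ x + c * (y - x) ≤ φ y := by
  obtain ⟨α, β, hα, hβ, hαβ, rfl⟩ := hy
  have hconc := hφ.2 hx hq hα hβ hαβ
  have hβc := mul_le_mul_of_nonneg_left hc hβ
  obtain rfl : α = 1 - β := by linarith
  simp only [smul_eq_mul] at hconc ⊢
  linarith

theorem add_mul_lt_of_mem_segment (hφ : ConcaveOn ℝ s φ) (hx : x ∈ s) (hq : q ∈ s)
    (hc : φ x < φ q + c * (x - q)) (hy : y ∈ segment ℝ x q) (hyx : y ≠ x) :
    φ x + c * (y - x) < φ y := by
  obtain ⟨α, β, hα, hβ, hαβ, rfl⟩ := hy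
  have hconc := hφ.2 hx hq hα hβ hαβ
  have hβ' : 0 < β := hβ.lt_of_ne' fun h => hyx (by simp_all)
  have hβc := mul_lt_mul_of_pos_left hc hβ'
  obtain rfl : α = 1 - β := by linarith
  simp only [smul_eq_mul] at hconc ⊢
  linarith

end Supergradient

section ConcaveOrder

variable {Ω : Type*} [MeasurableSpace Ω] {P : Measure Ω} {f g h : Ω → ℝ}

/-- The concave order of random variables: it differs from `ICVLe` in that the test functions
need not be monotone. As an expectation that does not exist is `0`, it is meaningful only for
functions whose concave images are integrable, such as essentially bounded ones. -/
def ConcaveLe (P : Measure Ω) (f g : Ω → ℝ) : Prop :=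
  ∀ φ : ℝ → ℝ, ConcaveOn ℝ univ φ → ∫ ω, φ (f ω) ∂P ≤ ∫ ω, φ (g ω) ∂P

/-- Strict domination in the concave order, the counterpart of `ICVLt`. -/
def ConcaveLt (P : Measure Ω) (f g : Ω → ℝ) : Prop :=
  ConcaveLe P f g ∧
    ∀ φ : ℝ → ℝ, StrictConcaveOn ℝ univ φ → ∫ ω, φ (f ω) ∂P < ∫ ω, φ (g ω) ∂P

theorem ConcaveLe.refl (f : Ω → ℝ) : ConcaveLe P f f := fun _ _ => le_rfl

theorem ConcaveLe.trans (hfg : ConcaveLe P f g) (hgh : ConcaveLe P g h) : ConcaveLe P f h :=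
  fun φ hφ => (hfg φ hφ).trans (hgh φ hφ)

theorem ConcaveLe.neg (hfg : ConcaveLe P f g) : ConcaveLe P (-f) (-g) := fun φ hφ =>
  hfg (fun x => φ (-x)) (hφ.comp_linearMap (-LinearMap.id))

theorem ConcaveLe.integral_sq_le (hfg : ConcaveLe P f g) :
    ∫ ω, g ω ^ 2 ∂P ≤ ∫ ω, f ω ^ 2 ∂P := by
  have hneg := hfg (fun x => -x ^ 2) even_two.convexOn_pow.neg
  simpa only [integral_neg, neg_le_neg_iff] using hneg

theorem ConcaveLt.integral_sq_lt (hfg : ConcaveLt P f g) :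
    ∫ ω, g ω ^ 2 ∂P < ∫ ω, f ω ^ 2 ∂P := by
  have hneg := hfg.2 (fun x => -x ^ 2) (even_two.strictConvexOn_pow two_ne_zero).neg
  simpa only [integral_neg, neg_lt_neg_iff] using hneg

variable [IsFiniteMeasure P]

theorem integrable_comp_of_concaveOn {φ : ℝ → ℝ} (hφ : ConcaveOn ℝ univ φ)
    (hf : MemLp f ∞ P) : Integrable (fun ω => φ (f ω)) P := by
  have hcont : Continuous φ := continuousOn_univ.1 (hφ.continuousOn isOpen_univ)
  obtain ⟨C, hC⟩ := isCompact_Icc.exists_bound_of_continuousOn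
    (s := Icc (-lpNorm f ∞ P) (lpNorm f ∞ P)) hcont.continuousOn
  exact .of_bound (hcont.comp_aestronglyMeasurable hf.1) C
    ((ae_le_lpNorm_exponent_top hf).mono fun ω hω => hC _ (abs_le.1 hω))

theorem ConcaveLe.ae_le {M : ℝ} (hfg : ConcaveLe P f g) (hg : Integrable g P)
    (hf : ∀ᵐ ω ∂P, f ω ≤ M) : ∀ᵐ ω ∂P, g ω ≤ M := by
  have hconc : ConcaveOn ℝ univ fun x : ℝ => min (M - x) 0 :=
    ((concaveOn_const M convex_univ).sub (convexOn_id convex_univ)).inf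
      (concaveOn_const 0 convex_univ)
  have hint : Integrable (fun ω => min (M - g ω) 0) P :=
    ((integrable_const M).sub hg).inf (integrable_zero _ _ _)
  have hzero : ∫ ω, min (M - f ω) 0 ∂P = 0 :=
    integral_eq_zero_of_ae (hf.mono fun ω hω => min_eq_right (sub_nonneg.2 hω))
  have hnonpos : ∀ ω, min (M - g ω) 0 ≤ 0 := fun ω => min_le_right _ _
  have hle := hfg _ hconc
  rw [hzero] at hle
  have heq := (integral_eq_iff_of_ae_le hint (integrable_zero _ _ _) (.of_forall hnonpos)).1
    (by simpa using (integral_nonpos hnonpos).antisymm hle)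
  exact heq.mono fun ω hω => sub_nonneg.1 (min_eq_right_iff.1 hω)

theorem ConcaveLe.ae_abs_le {M : ℝ} (hfg : ConcaveLe P f g) (hg : Integrable g P)
    (hf : ∀ᵐ ω ∂P, |f ω| ≤ M) : ∀ᵐ ω ∂P, |g ω| ≤ M := by
  filter_upwards [hfg.ae_le hg (hf.mono fun ω hω => (abs_le'.1 hω).1),
    hfg.neg.ae_le hg.neg (hf.mono fun ω hω => (abs_le'.1 hω).2)] with ω hle hneg_le
  exact abs_le'.2 ⟨hle, hneg_le⟩

theorem ConcaveLe.memLp_top (hfg : ConcaveLe P f g) (hf : MemLp f ∞ P) (hg : Integrable g P) :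
    MemLp g ∞ P :=
  memLp_top_of_bound hg.1 _ (hfg.ae_abs_le hg (ae_le_lpNorm_exponent_top hf))

section Contraction

variable {q : ℝ} (hf : MemLp f ∞ P) (hg : MemLp g ∞ P)

include hf hg

theorem integrable_comp_add_mul_sub {φ : ℝ → ℝ} (hφ : ConcaveOn ℝ univ φ) (c : ℝ) :
    Integrable (fun ω => φ (f ω) + c * (g ω - f ω)) P :=
  (integrable_comp_of_concaveOn hφ hf).add
    (((hg.integrable le_top).sub (hf.integrable le_top)).const_mul c)

variable (hint : ∫ ω, f ω ∂P = ∫ ω, g ω ∂P)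

include hint

theorem integral_comp_add_mul_sub {φ : ℝ → ℝ} (hφ : ConcaveOn ℝ univ φ) (c : ℝ) :
    ∫ ω, (φ (f ω) + c * (g ω - f ω)) ∂P = ∫ ω, φ (f ω) ∂P := by
  have hf' := hf.integrable le_top
  have hg' := hg.integrable le_top
  have hsub : Integrable (fun ω => c * (g ω - f ω)) P := (hg'.sub hf').const_mul c
  rw [integral_add (integrable_comp_of_concaveOn hφ hf) hsub, integral_const_mul,
    integral_sub hg' hf', hint, sub_self, mul_zero, add_zero]

theorem concaveLe_of_mem_segment (hseg : ∀ᵐ ω ∂P, g ω ∈ segment ℝ (f ω) q) :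
    ConcaveLe P f g := by
  intro φ hφ
  obtain ⟨c, hc⟩ := exists_supergradient (q := q) hφ (by simp)
  rw [← integral_comp_add_mul_sub hf hg hint hφ c]
  refine integral_mono_ae (integrable_comp_add_mul_sub hf hg hφ c)
    (integrable_comp_of_concaveOn hφ hg) ?_
  filter_upwards [hseg] with ω hω
  exact add_mul_le_of_mem_segment hφ trivial trivial (hc _ trivial) hω

theorem concaveLt_of_mem_segment (hseg : ∀ᵐ ω ∂P, g ω ∈ segment ℝ (f ω) q)
    (hne : ¬ g =ᵐ[P] f) : ConcaveLt P f g := by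
  have hle := concaveLe_of_mem_segment hf hg hint hseg
  refine ⟨hle, fun φ hφ => (hle φ hφ.concaveOn).lt_of_ne fun hφ_eq => hne ?_⟩
  obtain ⟨c, hc⟩ := exists_supergradient (q := q) hφ.concaveOn (by simp)
  have hlin := integrable_comp_add_mul_sub hf hg hφ.concaveOn c
  have heq := integral_comp_add_mul_sub hf hg hint hφ.concaveOn c
  have hlt (ω : Ω) (hω : g ω ∈ segment ℝ (f ω) q) (hgf : g ω ≠ f ω) :
      φ (f ω) + c * (g ω - f ω) < φ (g ω) := by
    have hfq : f ω ≠ q := by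
      intro hfq
      rw [hfq, segment_same, mem_singleton_iff] at hω
      exact hgf (hω.trans hfq.symm)
    exact add_mul_lt_of_mem_segment hφ.concaveOn trivial trivial
      (lt_of_supergradient hφ trivial hc trivial hfq) hω hgf
  have hpt := (integral_eq_iff_of_ae_le hlin (integrable_comp_of_concaveOn hφ.concaveOn hg)
    (hseg.mono fun ω hω => add_mul_le_of_mem_segment hφ.concaveOn trivial trivial
      (hc _ trivial) hω)).1 (heq.trans hφ_eq)
  filter_upwards [hseg, hpt] with ω hω hω_eq
  by_contra hgf
  exact (hlt ω hω hgf).ne hω_eq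

end Contraction

section Topology

variable {p : ℝ≥0∞} [Fact (1 ≤ p)] (hf : MemLp f ∞ P)

include hf

theorem convex_setOf_concaveLe : Convex ℝ {g : Lp ℝ p P | ConcaveLe P f g} := by
  intro u hu v hv a b ha hb hab φ hφ
  have hbdd {w : Lp ℝ p P} (hw : ConcaveLe P f w) : MemLp w ∞ P :=
    hw.memLp_top hf ((Lp.memLp w).integrable Fact.out)
  have hcoe : ⇑(a • u + b • v) =ᵐ[P] fun ω => a * u ω + b * v ω := by
    filter_upwards [Lp.coeFn_add (a • u) (b • v), Lp.coeFn_smul a u, Lp.coeFn_smul b v]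
      with ω hadd hu_smul hv_smul
    simp only [hadd, Pi.add_apply, hu_smul, hv_smul, Pi.smul_apply, smul_eq_mul]
  have hφu := (integrable_comp_of_concaveOn hφ (hbdd hu)).const_mul a
  have hφv := (integrable_comp_of_concaveOn hφ (hbdd hv)).const_mul b
  calc ∫ ω, φ (f ω) ∂P
      = a * ∫ ω, φ (f ω) ∂P + b * ∫ ω, φ (f ω) ∂P := by rw [← add_mul, hab, one_mul]
    _ ≤ a * ∫ ω, φ (u ω) ∂P + b * ∫ ω, φ (v ω) ∂P :=
        add_le_add (mul_le_mul_of_nonneg_left (hu φ hφ) ha) (mul_le_mul_of_nonneg_left (hv φ hφ) hb)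
    _ = ∫ ω, (a * φ (u ω) + b * φ (v ω)) ∂P := by
        rw [integral_add hφu hφv, integral_const_mul, integral_const_mul]
    _ ≤ ∫ ω, φ (a * u ω + b * v ω) ∂P :=
        integral_mono (hφu.add hφv)
          (integrable_comp_of_concaveOn hφ (((hbdd hu).const_mul a).add ((hbdd hv).const_mul b)))
          fun ω => hφ.2 trivial trivial ha hb hab
    _ = ∫ ω, φ ((a • u + b • v : Lp ℝ p P) ω) ∂P :=
        integral_congr_ae (hcoe.mono fun ω hω => congrArg φ hω.symm)

theorem isClosed_setOf_concaveLe : IsClosed {g : Lp ℝ p P | ConcaveLe P f g} := by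
  refine IsSeqClosed.isClosed fun u g hu hug φ hφ => ?_
  have hcont : Continuous φ := continuousOn_univ.1 (hφ.continuousOn isOpen_univ)
  obtain ⟨k, -, hk⟩ := (tendstoInMeasure_of_tendsto_Lp hug).exists_seq_tendsto_ae
  obtain ⟨C, hC⟩ := isCompact_Icc.exists_bound_of_continuousOn
    (s := Icc (-lpNorm f ∞ P) (lpNorm f ∞ P)) hcont.continuousOn
  have hbound (m : ℕ) : ∀ᵐ ω ∂P, ‖φ (u (k m) ω)‖ ≤ C := by
    have hm : ConcaveLe P f (u (k m)) := hu (k m)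
    filter_upwards [hm.ae_abs_le ((Lp.memLp _).integrable Fact.out)
      (ae_le_lpNorm_exponent_top hf)] with ω hω
    exact hC _ (abs_le.1 hω)
  have hlim : Tendsto (fun m => ∫ ω, φ (u (k m) ω) ∂P) atTop (nhds (∫ ω, φ (g ω) ∂P)) :=
    tendsto_integral_of_dominated_convergence (fun _ => C)
      (fun m => hcont.comp_aestronglyMeasurable (Lp.aestronglyMeasurable _))
      (integrable_const C) hbound (hk.mono fun ω hω => (hcont.tendsto _).comp hω)
  exact ge_of_tendsto' hlim fun m => hu (k m) φ hφ

end Topology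

end ConcaveOrder

section Transfer

variable {Ω : Type*} [MeasurableSpace Ω] {P : Measure Ω} [IsFiniteMeasure P] {A B : Set Ω}

/-- A mean-preserving transfer: each state of `A` gives up `ε * P B`, each state of `B` receives
`ε * P A`. -/
noncomputable def transfer (ε : ℝ) (hA : MeasurableSet A) (hB : MeasurableSet B) : Linf P :=
  indicatorConstLp ∞ hB (measure_ne_top P B) (ε * P.real A) -
    indicatorConstLp ∞ hA (measure_ne_top P A) (ε * P.real B)

variable (ε : ℝ) (hA : MeasurableSet A) (hB : MeasurableSet B)

theorem neg_transfer : -transfer (P := P) ε hA hB = transfer ε hB hA := neg_sub _ _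

theorem coeFn_transfer : ⇑(transfer (P := P) ε hA hB) =ᵐ[P] fun ω =>
    B.indicator (fun _ => ε * P.real A) ω - A.indicator (fun _ => ε * P.real B) ω := by
  rw [transfer]
  filter_upwards [Lp.coeFn_sub (indicatorConstLp ∞ hB (measure_ne_top P B) (ε * P.real A))
    (indicatorConstLp ∞ hA (measure_ne_top P A) (ε * P.real B)),
    indicatorConstLp_coeFn (p := ∞) (hs := hA) (hμs := measure_ne_top P A) (c := ε * P.real B),
    indicatorConstLp_coeFn (p := ∞) (hs := hB) (hμs := measure_ne_top P B) (c := ε * P.real A)]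
    with ω hsub hωA hωB
  rw [hsub, Pi.sub_apply, hωA, hωB]

theorem integral_transfer : ∫ ω, transfer (P := P) ε hA hB ω ∂P = 0 := by
  rw [integral_congr_ae (coeFn_transfer ε hA hB),
    integral_sub ((integrable_const _).indicator hB) ((integrable_const _).indicator hA),
    integral_indicator_const _ hB, integral_indicator_const _ hA, smul_eq_mul, smul_eq_mul]
  ring

variable {ε} {q : ℝ} {f : Linf P}

theorem concaveLt_add_transfer (hε : 0 < ε) (hA₀ : P A ≠ 0) (hB₀ : P B ≠ 0)
    (hfA : ∀ ω ∈ A, q < f ω - ε * P.real B) (hfB : ∀ ω ∈ B, f ω + ε * P.real A < q) :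
    ConcaveLt P f (f + transfer ε hA hB : Linf P) := by
  have hAε : 0 < ε * P.real A := mul_pos hε (ENNReal.toReal_pos hA₀ (measure_ne_top P A))
  have hBε : 0 < ε * P.real B := mul_pos hε (ENNReal.toReal_pos hB₀ (measure_ne_top P B))
  have hdisj : ∀ ω ∈ A, ω ∉ B := fun ω hωA hωB => by linarith [hfA ω hωA, hfB ω hωB]
  have hadd : ⇑(f + transfer ε hA hB : Linf P) =ᵐ[P] fun ω => f ω +
      (B.indicator (fun _ => ε * P.real A) ω - A.indicator (fun _ => ε * P.real B) ω) := by
    filter_upwards [Lp.coeFn_add f (transfer ε hA hB), coeFn_transfer ε hA hB] with ω hsum hω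
    rw [hsum, Pi.add_apply, hω]
  refine concaveLt_of_mem_segment (q := q) (Lp.memLp _) (Lp.memLp _) ?_ ?_ fun hae => ?_
  · rw [integral_congr_ae (Lp.coeFn_add f _), integral_add' ((Lp.memLp _).integrable le_top)
      ((Lp.memLp _).integrable le_top), integral_transfer, add_zero]
  · filter_upwards [hadd] with ω hω
    rw [hω, segment_eq_uIcc, mem_uIcc]
    by_cases hωA : ω ∈ A
    · have := hfA ω hωA
      rw [indicator_of_mem hωA, indicator_of_notMem (hdisj ω hωA)]
      exact .inr ⟨by linarith, by linarith⟩
    · by_cases hωB : ω ∈ B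
      · have := hfB ω hωB
        rw [indicator_of_mem hωB, indicator_of_notMem hωA]
        exact .inl ⟨by linarith, by linarith⟩
      · rw [indicator_of_notMem hωA, indicator_of_notMem hωB, sub_zero, add_zero]
        exact (le_total (f ω) q).imp (⟨le_rfl, ·⟩) (⟨·, le_rfl⟩)
  · obtain ⟨ω, hωA, hω, hω'⟩ :=
      ((frequently_ae_mem_iff.2 hA₀).and_eventually (hae.and hadd)).exists
    simp only [hω, indicator_of_mem hωA, indicator_of_notMem (hdisj ω hωA)] at hω'
    linarith

end Transfer

section Improvement

variable {Ω : Type*} [MeasurableSpace Ω] {P : Measure Ω} {ι : Type*} [Fintype ι]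
  {Y Z W : ι → Linf P}

/-- The improvements of an allocation `Y`: the allocations of the same total all of whose components
dominate those of `Y` in the concave order. -/
def improvements (Y : ι → Linf P) : Set (ι → Linf P) :=
  {Z | ∑ i, Z i = ∑ i, Y i ∧ ∀ i, ConcaveLe P (Y i) (Z i)}

theorem mem_improvements_trans (hZ : Z ∈ improvements Y) (hW : W ∈ improvements Z) :
    W ∈ improvements Y :=
  ⟨hW.1.trans hZ.1, fun i => (hZ.2 i).trans (hW.2 i)⟩

theorem add_single_sub_single_mem_improvements [DecidableEq ι] {i j : ι} (hij : i ≠ j) {τ : Linf P}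
    (hi : ConcaveLe P (Y i) (Y i + τ : Linf P)) (hj : ConcaveLe P (Y j) (Y j - τ : Linf P)) :
    Y + Pi.single i τ - Pi.single j τ ∈ improvements Y := by
  refine ⟨?_, fun k => ?_⟩
  · simp only [Pi.sub_apply, Pi.add_apply, Finset.sum_sub_distrib, Finset.sum_add_distrib,
      Finset.sum_pi_single', Finset.mem_univ, if_true, add_sub_cancel_right]
  · rcases eq_or_ne k i with rfl | hki
    · simpa [hij] using hi
    rcases eq_or_ne k j with rfl | hkj
    · simpa [hki] using hj
    · simpa [hki, hkj] using ConcaveLe.refl (P := P) (Y k)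

theorem exists_mem_improvements_of_measure_ne_zero [IsFiniteMeasure P] {i j : ι} (hij : i ≠ j)
    {a a' b b' : ℝ} (ha : a < a') (hb : b < b') (hA₀ : P {ω | a' < Y i ω ∧ Y j ω < b} ≠ 0)
    (hB₀ : P {ω | b' < Y j ω ∧ Y i ω < a} ≠ 0) :
    ∃ W ∈ improvements Y, ∃ k, ConcaveLt P (Y k) (W k) := by
  classical
  have hmeas (k : ι) : Measurable (Y k) := (Lp.stronglyMeasurable _).measurable
  set A := {ω | a' < Y i ω ∧ Y j ω < b}
  set B := {ω | b' < Y j ω ∧ Y i ω < a}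
  have hA : MeasurableSet A := (measurableSet_lt measurable_const (hmeas i)).inter
    (measurableSet_lt (hmeas j) measurable_const)
  have hB : MeasurableSet B := (measurableSet_lt measurable_const (hmeas j)).inter
    (measurableSet_lt (hmeas i) measurable_const)
  obtain ⟨ε, hε, hε_lt⟩ := exists_pos_mul_lt
    (lt_min (half_pos (sub_pos.2 ha)) (half_pos (sub_pos.2 hb))) (P.real univ)
  obtain ⟨hεa, hεb⟩ := lt_min_iff.1 hε_lt
  have hmass (S : Set Ω) : ε * P.real S ≤ P.real univ * ε := by
    rw [mul_comm]
    exact mul_le_mul_of_nonneg_right (measureReal_mono (subset_univ S)) hε.le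
  have hi : ConcaveLt P (Y i) (Y i + transfer ε hA hB : Linf P) :=
    concaveLt_add_transfer (q := (a + a') / 2) hA hB hε hA₀ hB₀
      (fun ω hω => by linarith [hω.1, hmass B]) (fun ω hω => by linarith [hω.2, hmass A])
  have hj : ConcaveLt P (Y j) (Y j - transfer ε hA hB : Linf P) := by
    rw [sub_eq_add_neg, neg_transfer]
    exact concaveLt_add_transfer (q := (b + b') / 2) hB hA hε hB₀ hA₀
      (fun ω hω => by linarith [hω.1, hmass A]) (fun ω hω => by linarith [hω.2, hmass B])
  refine ⟨_, add_single_sub_single_mem_improvements hij hi.1 hj.1, i, ?_⟩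
  simpa [hij] using hi

theorem comonotone_of_measure_eq_zero_or {n : ℕ} {Y : Fin n → Linf P}
    (hY : ∀ i j, i ≠ j → ∀ a a' b b' : ℝ, a < a' → b < b' →
      P {ω | a' < Y i ω ∧ Y j ω < b} = 0 ∨ P {ω | b' < Y j ω ∧ Y i ω < a} = 0) :
    Comonotone Y := by
  let N (i j : Fin n) (a b : ℝ) : Set Ω := {ω | a < Y i ω ∧ Y j ω < b}
  -- Only countably many quadrants have rational corners, so almost no state lies in a null one.
  let E : Set Ω := {ω | ∀ i j, ∀ a b : ℚ, P (N i j a b) = 0 → ω ∉ N i j a b}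
  have hE : ∀ᵐ ω ∂P, ω ∈ E := by
    simp only [E, mem_ofPred_eq, ae_all_iff]
    exact fun i j a b hN => measure_eq_zero_iff_ae_notMem.1 hN
  have not_opposite {i j ω₁ ω₂} (h₁ : ω₁ ∈ E) (h₂ : ω₂ ∈ E) (hi : Y i ω₂ < Y i ω₁)
      (hj : Y j ω₁ < Y j ω₂) : False := by
    have hij : i ≠ j := by rintro rfl; exact hi.asymm hj
    obtain ⟨a, ha, hai⟩ := exists_rat_btwn hi
    obtain ⟨a', haa', ha'⟩ := exists_rat_btwn hai
    obtain ⟨b, hb, hbj⟩ := exists_rat_btwn hj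
    obtain ⟨b', hbb', hb'⟩ := exists_rat_btwn hbj
    rcases hY i j hij a a' b b' haa' hbb' with hN | hN
    · exact h₁ i j a' b hN ⟨ha', hb⟩
    · exact h₂ j i b' a hN ⟨hb', ha⟩
  refine ⟨E, hE, fun ω₁ h₁ ω₂ h₂ i j => ?_⟩
  by_contra! hneg
  rcases mul_neg_iff.1 hneg with ⟨hi, hj⟩ | ⟨hi, hj⟩
  · exact not_opposite h₁ h₂ (sub_pos.1 hi) (sub_neg.1 hj)
  · exact not_opposite h₁ h₂ (sub_pos.1 hj) (sub_neg.1 hi)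

theorem exists_mem_improvements_concaveLt [IsFiniteMeasure P] {n : ℕ} {Y : Fin n → Linf P}
    (hY : ¬ Comonotone Y) : ∃ W ∈ improvements Y, ∃ k, ConcaveLt P (Y k) (W k) := by
  contrapose! hY
  refine comonotone_of_measure_eq_zero_or fun i j hij a a' b b' ha hb => ?_
  by_contra! hpos
  obtain ⟨W, hW, k, hk⟩ := exists_mem_improvements_of_measure_ne_zero hij ha hb hpos.1 hpos.2
  exact hY W hW k hk

end Improvement

section Minimization

variable {Ω : Type*} [MeasurableSpace Ω] {P : Measure Ω} {ι : Type*} [Fintype ι]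

theorem exists_forall_norm_le_of_isClosed_convex {H : Type*} [NormedAddCommGroup H]
    [InnerProductSpace ℝ H] [CompleteSpace H] {K : Set H} (hne : K.Nonempty) (hclosed : IsClosed K)
    (hconv : Convex ℝ K) : ∃ z ∈ K, ∀ w ∈ K, ‖z‖ ≤ ‖w‖ := by
  obtain ⟨z, hz, hz_min⟩ :=
    exists_norm_eq_iInf_of_complete_convex hne hclosed.isComplete hconv 0
  refine ⟨z, hz, fun w hw => ?_⟩
  have hle := ciInf_le ⟨0, forall_mem_range.2 fun w : K => norm_nonneg (0 - (w : H))⟩ ⟨w, hw⟩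
  rw [← hz_min] at hle
  simpa only [zero_sub, norm_neg] using hle

theorem norm_sq_eq_integral_sq (g : Lp ℝ 2 P) : ‖g‖ ^ 2 = ∫ ω, g ω ^ 2 ∂P := by
  rw [← real_inner_self_eq_norm_sq, L2.inner_def]
  exact integral_congr_ae (.of_forall fun ω => real_inner_self_eq_norm_sq (g ω) |>.trans
    (sq_abs (g ω)))

variable [IsFiniteMeasure P]

/-- The embedding of `L^∞` into `L²` over a finite measure space. -/
def toL2 : Linf P →+ Lp ℝ 2 P := AddSubgroup.inclusion (Lp.antitone le_top)

theorem toL2_injective : Function.Injective (toL2 (P := P)) := AddSubgroup.inclusion_injective _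

theorem coeFn_toL2 (g : Linf P) : ⇑(toL2 g) = g := rfl

theorem exists_toL2_eq_of_concaveLe {f : Linf P} {g : Lp ℝ 2 P} (hfg : ConcaveLe P f g) :
    ∃ g' : Linf P, toL2 g' = g := by
  have hg := hfg.memLp_top (Lp.memLp f) ((Lp.memLp g).integrable one_le_two)
  exact ⟨⟨g, Lp.mem_Lp_iff_memLp.2 hg⟩, rfl⟩

/-- The image of `improvements Y` in the Hilbert space of square-integrable random vectors. -/
def improvementsL2 (Y : ι → Linf P) : Set (PiLp 2 fun _ : ι => Lp ℝ 2 P) :=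
  {z | ∑ i, z i = ∑ i, toL2 (Y i) ∧ ∀ i, ConcaveLe P (Y i) (z i)}

theorem convex_improvementsL2 (Y : ι → Linf P) : Convex ℝ (improvementsL2 Y) := by
  intro u hu v hv a b ha hb hab
  refine ⟨?_, fun i => convex_setOf_concaveLe (Lp.memLp (Y i)) (hu.2 i) (hv.2 i) ha hb hab⟩
  simp only [PiLp.add_apply, PiLp.smul_apply, Finset.sum_add_distrib, ← Finset.smul_sum, hu.1,
    hv.1, ← add_smul, hab, one_smul]

theorem isClosed_improvementsL2 (Y : ι → Linf P) : IsClosed (improvementsL2 Y) := by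
  have hcont (i : ι) : Continuous fun z : PiLp 2 fun _ : ι => Lp ℝ 2 P => z i :=
    PiLp.continuous_apply 2 _ i
  simp only [improvementsL2, ofPred_and, ofPred_forall]
  exact (isClosed_eq (continuous_finsetSum _ fun i _ => hcont i) continuous_const).inter
    (isClosed_iInter fun i => (isClosed_setOf_concaveLe (Lp.memLp (Y i))).preimage (hcont i))

theorem exists_minimal_mem_improvements (Y : ι → Linf P) :
    ∃ Z ∈ improvements Y, ∀ W ∈ improvements Y,
      ∑ i, ∫ ω, Z i ω ^ 2 ∂P ≤ ∑ i, ∫ ω, W i ω ^ 2 ∂P := by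
  let incl (W : ι → Linf P) : PiLp 2 fun _ : ι => Lp ℝ 2 P := WithLp.toLp 2 fun i => toL2 (W i)
  have incl_mem {W} : incl W ∈ improvementsL2 Y ↔ W ∈ improvements Y :=
    and_congr_left' (by simp only [incl, ← map_sum, toL2_injective.eq_iff])
  have norm_sq_incl (W) : ‖incl W‖ ^ 2 = ∑ i, ∫ ω, W i ω ^ 2 ∂P := by
    simp only [PiLp.norm_sq_eq_of_L2, norm_sq_eq_integral_sq, incl, coeFn_toL2]
  obtain ⟨z, hz, hz_min⟩ := exists_forall_norm_le_of_isClosed_convex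
    ⟨_, incl_mem.2 ⟨rfl, fun i => .refl (Y i)⟩⟩ (isClosed_improvementsL2 Y)
    (convex_improvementsL2 Y)
  choose Z hZ using fun i => exists_toL2_eq_of_concaveLe (hz.2 i)
  obtain rfl : incl Z = z := PiLp.ext hZ
  refine ⟨Z, incl_mem.1 hz, fun W hW => ?_⟩
  rw [← norm_sq_incl, ← norm_sq_incl]
  exact pow_le_pow_left₀ (norm_nonneg _) (hz_min _ (incl_mem.2 hW)) 2

theorem exists_comonotone_mem_improvements {n : ℕ} (Y : Fin n → Linf P) :
    ∃ Z ∈ improvements Y, Comonotone Z := by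
  obtain ⟨Z, hZ, hZ_min⟩ := exists_minimal_mem_improvements Y
  refine ⟨Z, hZ, by_contra fun hnot => ?_⟩
  obtain ⟨W, hW, k, hk⟩ := exists_mem_improvements_concaveLt hnot
  refine (hZ_min W (mem_improvements_trans hZ hW)).not_gt ?_
  exact Finset.sum_lt_sum (fun i _ => (hW.2 i).integral_sq_le)
    ⟨k, Finset.mem_univ k, hk.integral_sq_lt⟩

end Minimization

section ParetoOptimality

variable {Ω : Type*} [MeasurableSpace Ω] {P : Measure Ω} {n : ℕ} {U : Fin n → Linf P → ℝ}
  {X Y Z : Fin n → Linf P}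

theorem ConcaveLe.icvLe {f g : Linf P} (hfg : ConcaveLe P f g) : ICVLe f g :=
  fun φ _ hφ => hfg φ hφ

theorem ConcaveLt.icvLt {f g : Linf P} (hfg : ConcaveLt P f g) : ICVLt f g :=
  ⟨hfg.1.icvLe, fun φ _ hφ => hfg.2 φ hφ⟩

theorem le_of_mem_improvements (hssd : ∀ i, SSDPreserving (U i)) (hZ : Z ∈ improvements Y)
    (i : Fin n) : U i (Y i) ≤ U i (Z i) :=
  hssd i _ _ (hZ.2 i).icvLe

theorem individuallyRational_of_mem_improvements (hssd : ∀ i, SSDPreserving (U i))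
    (hY : Y ∈ individuallyRational U X) (hZ : Z ∈ improvements Y) :
    Z ∈ individuallyRational U X :=
  ⟨hZ.1.trans hY.1, fun i => (hY.2 i).trans (le_of_mem_improvements hssd hZ i)⟩

theorem paretoOptimal_inter_comonotoneAllocations_subset :
    paretoOptimal U X ∩ comonotoneAllocations X ⊆ comonotoneParetoOptimal U X :=
  fun _ hY => ⟨hY.2, hY.1.1, fun ⟨Y', _, hY', hdom⟩ => hY.1.2 ⟨Y', hY', hdom⟩⟩

theorem comonotoneParetoOptimal_subset_paretoOptimal [IsFiniteMeasure P]
    (hssd : ∀ i, SSDPreserving (U i)) : comonotoneParetoOptimal U X ⊆ paretoOptimal U X := by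
  rintro Y ⟨-, hY, hopt⟩
  refine ⟨hY, fun ⟨Y', hY', hle, k, hlt⟩ => hopt ?_⟩
  obtain ⟨Z, hZ, hcom⟩ := exists_comonotone_mem_improvements Y'
  have hZ_rational := individuallyRational_of_mem_improvements hssd hY' hZ
  have hle_Z := le_of_mem_improvements hssd hZ
  exact ⟨Z, ⟨hZ_rational.1, hcom⟩, hZ_rational, fun i => (hle i).trans (hle_Z i), k,
    hlt.trans_le (hle_Z k)⟩

theorem paretoOptimal_subset_comonotoneAllocations [IsFiniteMeasure P]
    (hssd : ∀ i, SSDPreserving (U i)) (hstrict : ∀ i, StrictlySSDPreserving (U i)) :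
    paretoOptimal U X ⊆ comonotoneAllocations X := by
  rintro Y ⟨hY, hopt⟩
  refine ⟨hY.1, by_contra fun hcom => hopt ?_⟩
  obtain ⟨W, hW, k, hk⟩ := exists_mem_improvements_concaveLt hcom
  exact ⟨W, individuallyRational_of_mem_improvements hssd hY hW, le_of_mem_improvements hssd hW, k,
    hstrict k _ _ hk.icvLt⟩

end ParetoOptimality

end RiskSharing

open RiskSharing in
theorem corollary3p9_general {Ω : Type*} [MeasurableSpace Ω] {P : Measure Ω} [IsFiniteMeasure P]
    {n : ℕ} (X : Fin n → Linf P) {U : Fin n → Linf P → ℝ} (hssd : ∀ i, SSDPreserving (U i)) :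
    paretoOptimal U X ∩ comonotoneAllocations X = comonotoneParetoOptimal U X ∧
      ((∀ i, StrictlySSDPreserving (U i)) →
        paretoOptimal U X = comonotoneParetoOptimal U X) := by
  have heq : paretoOptimal U X ∩ comonotoneAllocations X = comonotoneParetoOptimal U X :=
    paretoOptimal_inter_comonotoneAllocations_subset.antisymm fun Y hY =>
      ⟨comonotoneParetoOptimal_subset_paretoOptimal hssd hY, hY.1⟩
  refine ⟨heq, fun hstrict => ?_⟩
  rw [← heq, inter_eq_left.2 (paretoOptimal_subset_comonotoneAllocations hssd hstrict)]

theorem corollary3p9 {Ω : Type*} [MeasurableSpace Ω] (P : Measure Ω) [IsProbabilityMeasure P]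
    (hP : RiskSharing.Atomless P) (n : ℕ) (X : Fin n → RiskSharing.Linf P)
    (U : Fin n → RiskSharing.Linf P → ℝ)
    (hconc : ∀ i, ConcaveOn ℝ Set.univ (U i))
    (hssd : ∀ i, RiskSharing.SSDPreserving (U i))
    (hprem : ∀ i, RiskSharing.IncreasingInPremium (U i)) :
    RiskSharing.paretoOptimal U X ∩ RiskSharing.comonotoneAllocations X =
        RiskSharing.comonotoneParetoOptimal U X ∧
      ((∀ i, RiskSharing.StrictlySSDPreserving (U i)) →
        RiskSharing.paretoOptimal U X = RiskSharing.comonotoneParetoOptimal U X) :=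
  corollary3p9_general X hssd
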